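/- **Theorem 9.2.** Let $d\in\mathbb N$ and $\omega\in\mathbb R^d$, and let $\mathcal A(\theta,\phi)$ be a real skew-symmetric $3\times3$ matrix that is a $C^1$ function of $(\theta,\phi)\in\mathbb R\times\mathbb R^d$ and is $2\pi$-periodic in $\theta$ and in each component of $\phi$ (a "fixed torus"). For $\phi\in\mathbb R^d$ let $\Phi(\cdot;\phi)$ be the principal solution matrix, i.e. the unique solution of $$\frac{\partial\Phi}{\partial\theta}(\theta;\phi)=\mathcal A(\theta,\omega\theta+\phi)\,\Phi(\theta;\phi),\qquad \Phi(0;\phi)=I .$$ A function $f:\mathbb R\to\mathbb R$ is quasiperiodic with tune vector $\nu\in\mathbb R^k$ if $f(\theta)=F(\nu\theta)$ for some continuous $F:\mathbb R^k\to\mathbb R$ that is $2\pi$-periodic in each variable; a matrix valued function is quasiperiodic if its entries are. Let $$\mathcal J=\begin{pmatrix}0&-1&0\\1&0&0\\0&0&0\end{pmatrix},$$ and let $\Xi(\phi)$ be the set of all $\nu\in[0,1)$ for which there is $U:\mathbb R\to SO(3)$, quasiperiodic with tune vector $(1,\omega)\in\mathbb R^{d+1}$, such that $\Phi(\theta;\phi)=U(\theta)\exp(\mathcal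 J\nu\theta)U(0)^T$ for all $\theta\in\mathbb R$. For a matrix valued $f$ on $\mathbb R$ and $\lambda\in\mathbb R$ put $$a(f,\lambda):=\lim_{T\to\infty}\frac1T\int_0^T f(\theta)e^{-i\lambda\theta}\,d\theta$$ when the limit exists, and $\Lambda(f):=\{\lambda\in\mathbb R:\ a(f,\lambda)\text{ exists and } a(f,\lambda)\neq0\}$. Suppose that the torus is off orbital resonance, i.e. $m\cdot(1,\omega)=0$ with $m\in\mathbb Z^{d+1}$ holds only for $m=0$, and that $\Xi(\phi_0)\neq\emptyset$ for some $\phi_0\in\mathbb R^d$. Then for every $\lambda\in\mathbb R$ the limit $a(\Phi(\cdot;\phi),\lambda)$ exists for all $\phi\in\mathbb R^d$ and is a continuous function of $\phi$. Moreover, $\Lambda(\Phi(\cdot;\phi))=\Lambda(\Phi(\cdot;\phi_0))$ for all $\phi\in\mathbb R^d$. -/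

import Mathlib

open Filter Topology MeasureTheory
open scoped Matrix

noncomputable section

namespace SpinOrbit

/-! ### Existence of the fundamental solution of a linear differential equation

The terms of the Dyson series: `X₀ = 1`, `Xₙ₊₁(t) = ∫₀ᵗ A(s) Xₙ(s) ds`. -/

def dysonTerm {R : Type*} [NormedRing R] [NormedAlgebra ℝ R] (A : ℝ → R) : ℕ → ℝ → R
  | 0 => fun _ => 1
  | n + 1 => fun t => ∫ s in (0 : ℝ)..t, A s * dysonTerm A n s

theorem continuous_dysonTerm {R : Type*} [NormedRing R] [NormedAlgebra ℝ R] [CompleteSpace R]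
    {A : ℝ → R} (hA : Continuous A) (n : ℕ) : Continuous (dysonTerm A n) := by
  induction n with
  | zero => exact continuous_const
  | succ n ih =>
    exact intervalIntegral.continuous_primitive
      (fun a b => (hA.mul ih).intervalIntegrable a b) 0

theorem hasDerivAt_dysonTerm_succ {R : Type*} [NormedRing R] [NormedAlgebra ℝ R]
    [CompleteSpace R] {A : ℝ → R} (hA : Continuous A) (n : ℕ) (t : ℝ) :
    HasDerivAt (dysonTerm A (n + 1)) (A t * dysonTerm A n t) t :=
  (hA.mul (continuous_dysonTerm hA n)).integral_hasStrictDerivAt 0 t |>.hasDerivAt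

theorem norm_dysonTerm_le {R : Type*} [NormedRing R] [NormedAlgebra ℝ R]
    {A : ℝ → R} {T K : ℝ} (hK0 : 0 ≤ K)
    (hK : ∀ t, |t| ≤ T → ‖A t‖ ≤ K) (n : ℕ) :
    ∀ t, |t| ≤ T → ‖dysonTerm A n t‖ ≤ ‖(1 : R)‖ * (K ^ n * |t| ^ n / n.factorial) := by
  induction n with
  | zero => intro t _; simp [dysonTerm]
  | succ n ih =>
    intro t ht
    have hfac : ((n + 1).factorial : ℝ) = (n + 1) * (n.factorial : ℝ) := by
      push_cast [Nat.factorial_succ]; ring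
    have hn : (n.factorial : ℝ) ≠ 0 := by positivity
    calc ‖dysonTerm A (n + 1) t‖
        ≤ ∫ s in Set.uIoc 0 t, ‖(1 : R)‖ * K ^ (n + 1) / n.factorial * |s - 0| ^ n := by
          rw [dysonTerm, intervalIntegral.norm_intervalIntegral_eq]
          apply norm_integral_le_of_norm_le
          · have : Continuous fun s : ℝ => ‖(1 : R)‖ * K ^ (n + 1) / n.factorial * |s - 0| ^ n := by
              fun_prop
            exact this.integrableOn_uIoc
          · refine (ae_restrict_mem measurableSet_uIoc).mono fun s hs => ?_
            have hst : |s| ≤ T := by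
              refine le_trans ?_ ht
              rcases Set.mem_uIoc.1 hs with h | h
              · rw [abs_of_pos h.1, abs_of_pos (h.1.trans_le h.2)]; exact h.2
              · rw [abs_of_nonpos h.2, abs_of_neg (h.1.trans_le h.2)]; linarith [h.1]
            calc ‖A s * dysonTerm A n s‖ ≤ ‖A s‖ * ‖dysonTerm A n s‖ := norm_mul_le _ _
              _ ≤ K * (‖(1 : R)‖ * (K ^ n * |s| ^ n / n.factorial)) :=
                  mul_le_mul (hK s hst) (ih s hst) (norm_nonneg _) hK0
              _ = ‖(1 : R)‖ * K ^ (n + 1) / n.factorial * |s - 0| ^ n := by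
                  rw [sub_zero]; ring
      _ = ‖(1 : R)‖ * (K ^ (n + 1) * |t| ^ (n + 1) / (n + 1).factorial) := by
          rw [integral_const_mul, integral_pow_abs_sub_uIoc, sub_zero, hfac]
          field_simp

theorem exists_fundamentalSolution {R : Type*} [NormedRing R] [NormedAlgebra ℝ R]
    [CompleteSpace R] {A : ℝ → R} (hA : Continuous A) :
    ∃ X : ℝ → R, X 0 = 1 ∧ ∀ t, HasDerivAt X (A t * X t) t := by
  have hbound : ∀ T : ℝ, ∃ K : ℝ, 0 ≤ K ∧ ∀ t, |t| ≤ T → ‖A t‖ ≤ K := by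
    intro T
    obtain ⟨K, hK⟩ := (isCompact_Icc (a := -T) (b := T)).exists_bound_of_continuousOn
      hA.continuousOn
    exact ⟨max K 0, le_max_right _ _, fun t ht => (hK t (abs_le.1 ht)).trans (le_max_left _ _)⟩
  have hsum : ∀ T K : ℝ, Summable fun n : ℕ => ‖(1 : R)‖ * (K ^ n * T ^ n / n.factorial) := by
    intro T K
    simpa [mul_pow] using (Real.summable_pow_div_factorial (K * T)).mul_left ‖(1 : R)‖
  have hS : ∀ t, Summable fun n => dysonTerm A n t := by
    intro t
    obtain ⟨K, hK0, hK⟩ := hbound |t|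
    exact Summable.of_norm_bounded (hsum |t| K) fun n => norm_dysonTerm_le hK0 hK n t le_rfl
  refine ⟨fun t => ∑' n, dysonTerm A n t, ?_, fun t => ?_⟩
  · change ∑' n, dysonTerm A n 0 = 1
    rw [tsum_eq_single 0]
    · rfl
    · rintro (_ | n) hn
      · exact absurd rfl hn
      · simp [dysonTerm]
  · obtain ⟨K, hK0, hK⟩ := hbound (|t| + 1)
    have key : HasDerivAt (fun z => ∑' n, dysonTerm A (n + 1) z)
        (∑' n, A t * dysonTerm A n t) t := by
      refine hasDerivAt_tsum_of_isPreconnected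
        (u := fun n : ℕ => K * (‖(1 : R)‖ * (K ^ n * (|t| + 1) ^ n / n.factorial)))
        (t := Metric.ball (0 : ℝ) (|t| + 1)) (y₀ := t)
        ((hsum _ _).mul_left K) Metric.isOpen_ball (convex_ball _ _).isPreconnected
        (fun n y _ => hasDerivAt_dysonTerm_succ hA n y) ?_ (by simp)
        ((summable_nat_add_iff 1).2 (hS t)) (by simp)
      intro n y hy
      have hy' : |y| ≤ |t| + 1 := by simpa using (mem_ball_zero_iff.1 hy).le
      calc ‖A y * dysonTerm A n y‖ ≤ ‖A y‖ * ‖dysonTerm A n y‖ := norm_mul_le _ _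
        _ ≤ K * (‖(1 : R)‖ * (K ^ n * (|t| + 1) ^ n / n.factorial)) := by
            refine mul_le_mul (hK y hy') ((norm_dysonTerm_le hK0 hK n y hy').trans ?_)
              (norm_nonneg _) hK0
            gcongr
    have hsplit : (fun z => ∑' n, dysonTerm A n z) =
        fun z => 1 + ∑' n, dysonTerm A (n + 1) z := by
      funext z
      rw [(hS z).tsum_eq_zero_add]
      rfl
    have h2 := key.const_add (1 : R)
    rw [(hS t).tsum_mul_left] at h2
    change HasDerivAt (fun z => ∑' n, dysonTerm A n z) (A t * ∑' n, dysonTerm A n t) t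
    rw [hsplit]
    exact h2

/-- Entrywise form for real `3 × 3` matrices. -/
theorem exists_principalSolution (A : ℝ → Matrix (Fin 3) (Fin 3) ℝ) (hA : Continuous A) :
    ∃ X : ℝ → Matrix (Fin 3) (Fin 3) ℝ, X 0 = 1 ∧
      ∀ θ i j, HasDerivAt (fun t => X t i j) ((A θ * X θ) i j) θ := by
  let _ : NormedRing (Matrix (Fin 3) (Fin 3) ℝ) := Matrix.linftyOpNormedRing
  let _ : NormedAlgebra ℝ (Matrix (Fin 3) (Fin 3) ℝ) := Matrix.linftyOpNormedAlgebra
  have : CompleteSpace (Matrix (Fin 3) (Fin 3) ℝ) := FiniteDimensional.complete ℝ _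
  obtain ⟨X, h0, hX⟩ := exists_fundamentalSolution hA
  refine ⟨X, h0, fun θ i j => ?_⟩
  let L : Matrix (Fin 3) (Fin 3) ℝ →L[ℝ] ℝ :=
    LinearMap.toContinuousLinearMap (Matrix.entryLinearMap ℝ ℝ i j)
  exact L.hasFDerivAt.comp_hasDerivAt θ (hX θ)

/-! ### Quasiperiodic functions, time averages and spectra -/

/-- A function of `k` real variables that is `2π`-periodic in each of them. -/
def IsTwoPiPeriodic {k : ℕ} {E : Type*} (F : (Fin k → ℝ) → E) : Prop :=
  ∀ (i : Fin k) (z : Fin k → ℝ), F (z + Pi.single i (2 * Real.pi)) = F z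

/-- A real function of one variable is quasiperiodic with tune vector `ν ∈ ℝᵏ`. -/
def IsQuasiperiodic {k : ℕ} (ν : Fin k → ℝ) (f : ℝ → ℝ) : Prop :=
  ∃ F : (Fin k → ℝ) → ℝ, Continuous F ∧ IsTwoPiPeriodic F ∧ ∀ θ : ℝ, f θ = F (θ • ν)

/-- A tune vector is nonresonant if its entries are linearly independent over the integers. -/
def IsNonresonant {k : ℕ} (ν : Fin k → ℝ) : Prop :=
  ∀ m : Fin k → ℤ, ∑ i, (m i : ℝ) * ν i = 0 → m = 0

/-- The coefficient `a(f,lam) = lim_{T → ∞} (1/T) ∫₀ᵀ f(θ) exp(-i lam θ) dθ`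
exists and equals `a`. The integral and the limit are taken entrywise. -/
def HasCoeff (f : ℝ → Matrix (Fin 3) (Fin 3) ℂ) (lam : ℝ) (a : Matrix (Fin 3) (Fin 3) ℂ) :
    Prop :=
  ∀ i j, Tendsto
    (fun T : ℝ => (1 / (T : ℂ)) *
      ∫ θ in (0 : ℝ)..T, f θ i j * Complex.exp (-Complex.I * (lam : ℂ) * (θ : ℂ)))
    atTop (𝓝 (a i j))

/-- The spectrum `Λ(f)`: all real `lam` for which `a(f,lam)` is nonzero. -/
def specSet (f : ℝ → Matrix (Fin 3) (Fin 3) ℂ) : Set ℝ :=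
  {lam | ∃ a : Matrix (Fin 3) (Fin 3) ℂ, HasCoeff f lam a ∧ a ≠ 0}

/-! ### Spin motion on a fixed torus -/

/-- The data of a fixed torus with `d` orbital angles: the orbital tune `ω` and the matrix
`𝒜(θ,φ)` of the equation of spin motion, which is real skew-symmetric, `C¹`, and `2π`-periodic
in `θ` and in each component of `φ`. -/
structure Torus (d : ℕ) where
  omega : Fin d → ℝ
  mat : ℝ → (Fin d → ℝ) → Matrix (Fin 3) (Fin 3) ℝ
  mat_contDiff : ∀ i j, ContDiff ℝ 1 (fun p : ℝ × (Fin d → ℝ) => mat p.1 p.2 i j)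
  mat_skew : ∀ θ φ, (mat θ φ)ᵀ = -mat θ φ
  mat_periodic_theta : ∀ θ φ, mat (θ + 2 * Real.pi) φ = mat θ φ
  mat_periodic_phi : ∀ θ, IsTwoPiPeriodic (mat θ)

namespace Torus

variable {d : ℕ} (𝒯 : Torus d)

/-- The tune vector `(1, ω) ∈ ℝᵈ⁺¹`. -/
def tune : Fin (d + 1) → ℝ := Fin.cons 1 𝒯.omega

/-- The torus is off orbital resonance. -/
def OffOrbitalResonance : Prop := IsNonresonant 𝒯.tune

/-- `A(θ; φ) = 𝒜(θ, ωθ + φ)`. -/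
def orbitMat (φ : Fin d → ℝ) (θ : ℝ) : Matrix (Fin 3) (Fin 3) ℝ :=
  𝒯.mat θ (θ • 𝒯.omega + φ)

theorem continuous_orbitMat (φ : Fin d → ℝ) : Continuous (𝒯.orbitMat φ) := by
  refine continuous_matrix fun i j => ?_
  have h : Continuous fun θ : ℝ => (θ, θ • 𝒯.omega + φ) := by fun_prop
  exact (𝒯.mat_contDiff i j).continuous.comp h

/-- The principal solution matrix `Φ(θ; φ)`: the solution of `∂Φ/∂θ = A(θ; φ) Φ`,
`Φ(0; φ) = I`. -/
def Phi (φ : Fin d → ℝ) : ℝ → Matrix (Fin 3) (Fin 3) ℝ :=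
  Classical.choose (exists_principalSolution (𝒯.orbitMat φ) (𝒯.continuous_orbitMat φ))

theorem Phi_zero (φ : Fin d → ℝ) : 𝒯.Phi φ 0 = 1 :=
  (Classical.choose_spec
    (exists_principalSolution (𝒯.orbitMat φ) (𝒯.continuous_orbitMat φ))).1

theorem hasDerivAt_Phi (φ : Fin d → ℝ) (θ : ℝ) (i j : Fin 3) :
    HasDerivAt (fun t => 𝒯.Phi φ t i j) ((𝒯.orbitMat φ θ * 𝒯.Phi φ θ) i j) θ :=
  (Classical.choose_spec
    (exists_principalSolution (𝒯.orbitMat φ) (𝒯.continuous_orbitMat φ))).2 θ i j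

/-- `Φ(·; φ)` regarded as a complex matrix valued function. -/
def PhiC (φ : Fin d → ℝ) (θ : ℝ) : Matrix (Fin 3) (Fin 3) ℂ :=
  (𝒯.Phi φ θ).map fun x : ℝ => (x : ℂ)

end Torus

/-- The generator `𝒥` of the rotations about the third axis. -/
def genJ : Matrix (Fin 3) (Fin 3) ℝ := !![0, -1, 0; 1, 0, 0; 0, 0, 0]

namespace Torus

variable {d : ℕ} (𝒯 : Torus d)

/-- `U` is a proper uniform precession frame at `φ` with uniform precession rate `ν`:
`ν ∈ [0,1)`, `U` takes values in `SO(3)`, `Φ(θ; φ) = U(θ) exp(𝒥νθ) U(0)ᵀ` for all `θ`, and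
the entries of `U` are quasiperiodic with tune vector `(1, ω)`. -/
structure IsProperUPF (φ : Fin d → ℝ) (U : ℝ → Matrix (Fin 3) (Fin 3) ℝ) (ν : ℝ) : Prop where
  rate_mem : ν ∈ Set.Ico (0 : ℝ) 1
  mem_SO3 : ∀ θ, U θ ∈ Matrix.specialOrthogonalGroup (Fin 3) ℝ
  standard_form : ∀ θ, 𝒯.Phi φ θ = U θ * NormedSpace.exp ((ν * θ) • genJ) * (U 0)ᵀ
  quasiperiodic : ∀ i j, IsQuasiperiodic 𝒯.tune (fun θ => U θ i j)

/-- The set `Ξ(φ)` of all proper uniform precession rates at `φ`. -/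
def Xi (φ : Fin d → ℝ) : Set ℝ := {ν | ∃ U, 𝒯.IsProperUPF φ U ν}

end Torus

end SpinOrbit

end

/-!
Write `τ = (1, ω)`. A proper uniform precession frame at `φ₀` has the form `U(θ) = V(θτ)` with `V`
continuous and periodic on `ℝᵈ⁺¹`, and the standard form at `φ₀` says that
`V(z + θτ) exp(𝒥νθ) V(z)ᵀ` solves the equation of spin motion along the orbit of `z` whenever `z` lies
on the line `ℝτ`. Off orbital resonance this line is dense in the torus
(`IsNonresonant.eq_zero_of_line`), so the integrated equation holds for every `z`, and uniqueness of
the solution gives `Φ(θ; φ) = V(z + θτ) exp(𝒥νθ) V(z)ᵀ` with `z = (0, φ - φ₀)`, for every `φ`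
(`Torus.IsProperUPF.exists_frameField`).

The rotation `exp(𝒥νθ)` is the sum of `exp(icνθ) P_c` over the eigenvalues `ic` of `𝒥`, with `c = 1`,
`-1`, `0` and eigenprojections `P_c`. The coefficient of `Φ(·; φ)` at `lam` is therefore
`(∑ M_c(z) P_c) V(z)ᵀ`, where `M_c(z)` is the average of `V(z + θτ) exp(-i(lam - cν)θ)`. By Weyl's
theorem this average exists and equals `χ_c(z) B_c` with a constant matrix `B_c` and a continuous,
nowhere vanishing factor `χ_c`: a character of the torus if `lam - cν = m · τ` with `m` integral,
and otherwise `B_c = 0` (`IsNonresonant.exists_tendsto_lineAvg`). The coefficient is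
continuous in `φ`, and since `V(z)` is orthogonal and the `P_c` are complementary projections it
vanishes exactly if all `B_c P_c` do, a condition in which `φ` does not occur.
-/

noncomputable section

namespace SpinOrbit

/-! ### Averages of periodic functions along a nonresonant line -/

section LineAverages

open UnitAddTorus

variable {k : ℕ}

/-- The projection `ℝᵏ → (ℝ/ℤ)ᵏ`, rescaled so that its fibres are the classes
modulo `2πℤᵏ`. -/
def torusMk (z : Fin k → ℝ) : UnitAddTorus (Fin k) :=
  fun i => ((z i / (2 * Real.pi) : ℝ) : UnitAddCircle)

theorem continuous_torusMk : Continuous (torusMk (k := k)) :=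
  continuous_pi fun i => continuous_quotient_mk'.comp (by fun_prop)

theorem isOpenQuotientMap_torusMk : IsOpenQuotientMap (torusMk (k := k)) := by
  refine IsOpenQuotientMap.piMap
    (f := fun (_ : Fin k) (x : ℝ) => ((x / (2 * Real.pi) : ℝ) : UnitAddCircle)) fun _ => ?_
  simp only [div_eq_mul_inv]
  exact QuotientAddGroup.isOpenQuotientMap_mk.comp
    (Homeomorph.mulRight₀ _ (inv_ne_zero Real.two_pi_pos.ne')).isOpenQuotientMap

theorem IsTwoPiPeriodic.eq_of_torusMk_eq {E : Type*} {F : (Fin k → ℝ) → E}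
    (hF : IsTwoPiPeriodic F) {z w : Fin k → ℝ} (h : torusMk z = torusMk w) : F z = F w := by
  have hsum : ∀ (n : Fin k → ℤ) (s : Finset (Fin k)),
      Function.Periodic F (∑ i ∈ s, n i • Pi.single i (2 * Real.pi)) := by
    intro n s
    induction s using Finset.induction_on with
    | empty => intro z; simp
    | insert i s hi ih =>
      rw [Finset.sum_insert hi]
      exact (Function.Periodic.zsmul (fun z => hF i z) (n i)).add_period ih
  have hn : ∀ i, ∃ n : ℤ, z i = w i + n * (2 * Real.pi) := by
    intro i
    have hi : ((z i / (2 * Real.pi) : ℝ) : UnitAddCircle) = (w i / (2 * Real.pi) : ℝ) :=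
      congrFun h i
    rw [← sub_eq_zero, ← AddCircle.coe_sub, AddCircle.coe_eq_zero_iff] at hi
    obtain ⟨n, hn⟩ := hi
    refine ⟨n, ?_⟩
    have hπ := Real.pi_ne_zero
    rw [zsmul_eq_mul, mul_one] at hn
    rw [hn]
    field_simp
    ring
  choose n hn using hn
  have hz : z = w + ∑ i, n i • (Pi.single i (2 * Real.pi) : Fin k → ℝ) := by
    funext j
    rw [Pi.add_apply, Finset.sum_apply, Finset.sum_eq_single j]
    · simp [hn j]
    · intro b _ hb
      simp [Pi.single_eq_of_ne hb.symm]
    · simp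
  rw [hz]
  exact hsum n Finset.univ w

/-- A continuous `2π`-periodic function descends to the torus. -/
theorem IsTwoPiPeriodic.exists_lift {F : (Fin k → ℝ) → ℂ} (hF : IsTwoPiPeriodic F)
    (hc : Continuous F) : ∃ g : C(UnitAddTorus (Fin k), ℂ), ∀ z, g (torusMk z) = F z := by
  let p : C(Fin k → ℝ, UnitAddTorus (Fin k)) := ⟨torusMk, continuous_torusMk⟩
  have hp : Topology.IsQuotientMap p := isOpenQuotientMap_torusMk.isQuotientMap
  refine ⟨hp.lift ⟨F, hc⟩ fun a b hab => hF.eq_of_torusMk_eq hab, fun z => ?_⟩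
  exact DFunLike.congr_fun (hp.lift_comp ⟨F, hc⟩ fun a b hab => hF.eq_of_torusMk_eq hab) z

theorem mFourier_torusMk (n : Fin k → ℤ) (z : Fin k → ℝ) :
    mFourier n (torusMk z) = Complex.exp (Complex.I * ((∑ i, (n i : ℝ) * z i : ℝ) : ℂ)) := by
  have h2 : (Real.pi : ℂ) ≠ 0 := by exact_mod_cast Real.pi_ne_zero
  simp only [mFourier, torusMk, ContinuousMap.coe_mk, fourier_coe_apply]
  rw [← Complex.exp_sum]
  congr 1
  push_cast
  rw [Finset.mul_sum]
  refine Finset.sum_congr rfl fun i _ => ?_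
  field_simp

/-- The normalized Haar measure of the torus. -/
abbrev torusMeasure (k : ℕ) : Measure (UnitAddTorus (Fin k)) :=
  Measure.pi fun _ => AddCircle.haarAddCircle

theorem integral_mFourier (n : Fin k → ℤ) :
    ∫ x, mFourier n x ∂(torusMeasure k) = if n = 0 then 1 else 0 := by
  split_ifs with h
  · simp [h, mFourier_zero]
  · obtain ⟨i, hi⟩ := Function.ne_iff.mp h
    simp only [mFourier, ContinuousMap.coe_mk]
    rw [integral_fintype_prod_eq_prod]
    refine Finset.prod_eq_zero (Finset.mem_univ i) ?_
    have := (orthonormal_iff_ite.mp (orthonormal_fourier (T := 1))) 0 (n i)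
    rw [ContinuousMap.inner_toLp (AddCircle.haarAddCircle (T := 1))] at this
    rw [if_neg (fun h => hi h.symm)] at this
    simpa using this

/-- The finite-time average along the line through `z` with direction `ν`, at frequency `lam`. -/
def lineAvg (ν : Fin k → ℝ) (lam : ℝ) (z : Fin k → ℝ) (T : ℝ) (g : (Fin k → ℝ) → ℂ) : ℂ :=
  (1 / (T : ℂ)) * ∫ θ in (0 : ℝ)..T,
    g (z + θ • ν) * Complex.exp (-Complex.I * (lam : ℂ) * (θ : ℂ))

theorem tendsto_avg_exp (c : ℝ) :
    Tendsto (fun T : ℝ => (1 / (T : ℂ)) * ∫ θ in (0 : ℝ)..T, Complex.exp (Complex.I * c * θ))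
      atTop (𝓝 (if c = 0 then 1 else 0)) := by
  split_ifs with h
  · refine tendsto_const_nhds.congr' ?_
    filter_upwards [eventually_gt_atTop 0] with T hT
    have : (T : ℂ) ≠ 0 := by exact_mod_cast hT.ne'
    simp [h, this]
  · have hc : Complex.I * (c : ℂ) ≠ 0 := mul_ne_zero Complex.I_ne_zero (by exact_mod_cast h)
    rw [tendsto_zero_iff_norm_tendsto_zero]
    have hlim : Tendsto (fun T : ℝ => (2 / |c|) * T⁻¹) atTop (𝓝 0) := by
      simpa using tendsto_inv_atTop_zero.const_mul (2 / |c|)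
    refine squeeze_zero' (Eventually.of_forall fun _ => norm_nonneg _) ?_ hlim
    filter_upwards [eventually_gt_atTop 0] with T hT
    rw [integral_exp_mul_complex hc, norm_mul, norm_div, norm_div, norm_one, norm_mul,
      Complex.norm_I, one_mul, Complex.norm_real, Complex.norm_real, Real.norm_eq_abs,
      Real.norm_eq_abs, abs_of_pos hT]
    have h1 : ∀ x : ℝ, ‖Complex.exp (Complex.I * c * x)‖ = 1 := by
      intro x
      rw [mul_assoc, mul_comm, ← Complex.ofReal_mul, Complex.norm_exp_ofReal_mul_I]
    have := norm_sub_le (Complex.exp (Complex.I * c * T)) (Complex.exp (Complex.I * c * (0 : ℝ)))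
    rw [h1, h1] at this
    have hc' : 0 < |c| := abs_pos.2 h
    rw [one_div, mul_comm]
    gcongr
    linarith

theorem tendsto_lineAvg_mFourier (ν : Fin k → ℝ) (lam : ℝ) (z : Fin k → ℝ) (n : Fin k → ℤ) :
    Tendsto (fun T => lineAvg ν lam z T fun w => mFourier n (torusMk w)) atTop
      (𝓝 (if ∑ i, (n i : ℝ) * ν i = lam then mFourier n (torusMk z) else 0)) := by
  have := (tendsto_avg_exp (∑ i, (n i : ℝ) * ν i - lam)).const_mul (mFourier n (torusMk z))
  simp only [sub_eq_zero, mul_ite, mul_one, mul_zero] at this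
  refine this.congr fun T => ?_
  rw [lineAvg, mul_left_comm, ← intervalIntegral.integral_const_mul]
  congr 2
  funext θ
  rw [mFourier_torusMk, mFourier_torusMk, ← Complex.exp_add, ← Complex.exp_add]
  congr 1
  simp only [Pi.add_apply, Pi.smul_apply, smul_eq_mul, mul_add, Finset.sum_add_distrib,
    mul_left_comm _ θ, ← Finset.mul_sum]
  push_cast
  ring

theorem continuous_line_integrand (ν : Fin k → ℝ) (lam : ℝ) (z : Fin k → ℝ)
    {g : (Fin k → ℝ) → ℂ} (hg : Continuous g) :
    Continuous fun θ : ℝ =>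
      g (z + θ • ν) * Complex.exp (-Complex.I * (lam : ℂ) * (θ : ℂ)) := by
  have : Continuous fun θ : ℝ => z + θ • ν := by fun_prop
  have := hg.comp this
  simp only [Function.comp_def] at this
  fun_prop

theorem lineAvg_add (ν : Fin k → ℝ) (lam : ℝ) (z : Fin k → ℝ) (T : ℝ)
    {f g : (Fin k → ℝ) → ℂ} (hf : Continuous f) (hg : Continuous g) :
    lineAvg ν lam z T (fun w => f w + g w) = lineAvg ν lam z T f + lineAvg ν lam z T g := by
  simp only [lineAvg, add_mul]
  rw [intervalIntegral.integral_add, mul_add]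
  · exact (continuous_line_integrand ν lam z hf).intervalIntegrable _ _
  · exact (continuous_line_integrand ν lam z hg).intervalIntegrable _ _

theorem lineAvg_const_mul (ν : Fin k → ℝ) (lam : ℝ) (z : Fin k → ℝ) (T : ℝ)
    (c : ℂ) (f : (Fin k → ℝ) → ℂ) :
    lineAvg ν lam z T (fun w => c * f w) = c * lineAvg ν lam z T f := by
  simp only [lineAvg, mul_assoc]
  rw [intervalIntegral.integral_const_mul, mul_left_comm]

theorem norm_lineAvg_le (ν : Fin k → ℝ) (lam : ℝ) (z : Fin k → ℝ) (T : ℝ)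
    {f : (Fin k → ℝ) → ℂ} {C : ℝ} (hC : ∀ w, ‖f w‖ ≤ C) : ‖lineAvg ν lam z T f‖ ≤ C := by
  have hC0 : 0 ≤ C := (norm_nonneg _).trans (hC 0)
  have h := intervalIntegral.norm_integral_le_of_norm_le_const (a := 0) (b := T) (C := C)
    (f := fun θ : ℝ => f (z + θ • ν) * Complex.exp (-Complex.I * (lam : ℂ) * (θ : ℂ))) (by
      intro θ _
      have : -Complex.I * (lam : ℂ) * (θ : ℂ) = ((-lam * θ : ℝ) : ℂ) * Complex.I := by
        push_cast; ring
      rw [norm_mul, this, Complex.norm_exp_ofReal_mul_I, mul_one]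
      exact hC _)
  rw [sub_zero] at h
  rw [lineAvg, norm_mul, norm_div, norm_one, Complex.norm_real, Real.norm_eq_abs]
  rcases eq_or_ne T 0 with rfl | hT
  · simpa using hC0
  · have : 0 < |T| := abs_pos.2 hT
    rw [one_div, inv_mul_le_iff₀ this, mul_comm |T|]
    exact h

/-- The averages are contractions of `C((ℝ/ℤ)ᵏ, ℂ)` uniformly in the time, so their convergence
to a bounded functional has to be checked on the monomials only. -/
theorem tendsto_lineAvg_of_mFourier (ν : Fin k → ℝ) (lam : ℝ) (z : Fin k → ℝ)
    (Λ : C(UnitAddTorus (Fin k), ℂ) →L[ℂ] ℂ)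
    (hΛ : ∀ n : Fin k → ℤ,
      (if ∑ i, (n i : ℝ) * ν i = lam then mFourier n (torusMk z) else 0) = Λ (mFourier n))
    (g : C(UnitAddTorus (Fin k), ℂ)) :
    Tendsto (fun T => lineAvg ν lam z T fun w => g (torusMk w)) atTop (𝓝 (Λ g)) := by
  have hcont : ∀ g : C(UnitAddTorus (Fin k), ℂ), Continuous fun w : Fin k → ℝ => g (torusMk w) :=
    fun g => g.continuous.comp continuous_torusMk
  let A : ℝ → C(UnitAddTorus (Fin k), ℂ) → ℂ := fun T g =>
    lineAvg ν lam z T fun w => g (torusMk w)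
  have hA : Equicontinuous A := by
    refine (LipschitzWith.uniformEquicontinuous A 1 fun T => ?_).equicontinuous
    refine LipschitzWith.of_dist_le_mul fun f g => ?_
    rw [NNReal.coe_one, one_mul, dist_eq_norm, dist_eq_norm]
    have h1 : A T f - A T g = lineAvg ν lam z T fun w => (f - g) (torusMk w) := by
      have := lineAvg_add ν lam z T (hcont (f - g)) (hcont g)
      simp only [ContinuousMap.sub_apply, sub_add_cancel] at this ⊢
      simp only [A, this, add_sub_cancel_right]
    rw [h1]
    exact norm_lineAvg_le ν lam z T fun w => (f - g).norm_coe_le_norm _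
  have hclosed : IsClosed {g | Tendsto (A · g) atTop (𝓝 (Λ g))} :=
    hA.isClosed_setOfPred_tendsto Λ.continuous
  have hspan : (Submodule.span ℂ (Set.range (mFourier (d := Fin k))) : Set _) ⊆
      {g | Tendsto (A · g) atTop (𝓝 (Λ g))} := by
    intro g hg
    induction hg using Submodule.span_induction with
    | mem x hx =>
      obtain ⟨n, rfl⟩ := hx
      rw [Set.mem_ofPred_eq, ← hΛ]
      exact tendsto_lineAvg_mFourier ν lam z n
    | zero =>
      have h0 : ∀ T, A T 0 = 0 := fun T => by simp [A, lineAvg]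
      simp [h0]
    | add x y _ _ hx hy =>
      have := Tendsto.add hx hy
      rw [Set.mem_ofPred_eq, map_add]
      exact this.congr fun T => (lineAvg_add ν lam z T (hcont x) (hcont y)).symm
    | smul c x _ hx =>
      have := Tendsto.const_mul c hx
      rw [Set.mem_ofPred_eq, map_smul]
      exact this.congr fun T => (lineAvg_const_mul ν lam z T c _).symm
  have := hclosed.closure_subset_iff.2 hspan
  have htop := congrArg (fun S : Submodule ℂ C(UnitAddTorus (Fin k), ℂ) =>
    (S : Set C(UnitAddTorus (Fin k), ℂ)))
    (span_mFourier_closure_eq_top (d := Fin k))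
  simp only [Submodule.topologicalClosure_coe, Submodule.top_coe] at htop
  rw [htop] at this
  exact this (Set.mem_univ g)

/-- Weyl's theorem with a frequency: if `lam = m · ν`, then the average of `g` is the `m`-th Fourier
mode of `g`. -/
theorem IsNonresonant.tendsto_lineAvg {ν : Fin k → ℝ} (hν : IsNonresonant ν)
    (m : Fin k → ℤ) (z : Fin k → ℝ) (g : C(UnitAddTorus (Fin k), ℂ)) :
    Tendsto (fun T => lineAvg ν (∑ i, (m i : ℝ) * ν i) z T fun w => g (torusMk w)) atTop
      (𝓝 (mFourier m (torusMk z) * ∫ x, mFourier (-m) x * g x ∂(torusMeasure k))) := by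
  have hint : ∀ g : C(UnitAddTorus (Fin k), ℂ),
      Integrable (fun x => mFourier (-m) x * g x) (torusMeasure k) := fun g =>
    ((mFourier (-m)) * g).continuous.integrable_of_hasCompactSupport
      (HasCompactSupport.of_compactSpace _)
  let Λ₀ : C(UnitAddTorus (Fin k), ℂ) →ₗ[ℂ] ℂ :=
    { toFun := fun g =>
        mFourier m (torusMk z) * ∫ x, mFourier (-m) x * g x ∂(torusMeasure k)
      map_add' := fun f g => by
        simp only [ContinuousMap.add_apply, mul_add]
        rw [integral_add (hint f) (hint g), mul_add]
      map_smul' := fun c f => by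
        simp only [ContinuousMap.smul_apply, smul_eq_mul, RingHom.id_apply,
          mul_left_comm _ c]
        rw [integral_const_mul, mul_left_comm] }
  have hone : ∀ (n : Fin k → ℤ) x, ‖mFourier n x‖ ≤ 1 := fun n x =>
    ((mFourier n).norm_coe_le_norm x).trans mFourier_norm.le
  let Λ : C(UnitAddTorus (Fin k), ℂ) →L[ℂ] ℂ := Λ₀.mkContinuous 1 fun g => by
    have h := norm_integral_le_of_norm_le_const (μ := torusMeasure k)
      (f := fun x => mFourier (-m) x * g x) (C := ‖g‖) (Eventually.of_forall fun x => by
        rw [norm_mul]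
        exact (mul_le_mul (hone _ x) (g.norm_coe_le_norm x) (norm_nonneg _) zero_le_one).trans
          (one_mul _).le)
    rw [probReal_univ, mul_one] at h
    change ‖mFourier m (torusMk z) * _‖ ≤ _
    rw [norm_mul]
    exact mul_le_mul (hone _ _) h (norm_nonneg _) zero_le_one
  refine tendsto_lineAvg_of_mFourier ν _ z Λ (fun n => ?_) g
  change _ = mFourier m (torusMk z) * ∫ x, mFourier (-m) x * mFourier n x ∂(torusMeasure k)
  simp only [← mFourier_add, integral_mFourier]
  have hiff : ∑ i, (n i : ℝ) * ν i = ∑ i, (m i : ℝ) * ν i ↔ -m + n = 0 := by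
    constructor
    · intro h
      refine hν _ ?_
      simp only [Pi.add_apply, Pi.neg_apply, Int.cast_add, Int.cast_neg, add_mul,
        Finset.sum_add_distrib, h, neg_mul, Finset.sum_neg_distrib, neg_add_cancel]
    · intro h
      rw [neg_add_eq_zero.1 h]
  by_cases h : -m + n = 0
  · rw [if_pos (hiff.2 h), if_pos h, mul_one, neg_add_eq_zero.1 h]
  · rw [if_neg (mt hiff.1 h), if_neg h, mul_zero]

/-- The averages at a fixed frequency of all continuous periodic functions depend on the base
point through one and the same nowhere vanishing factor. -/
theorem IsNonresonant.exists_tendsto_lineAvg {ν : Fin k → ℝ} (hν : IsNonresonant ν) (lam : ℝ) :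
    ∃ χ : (Fin k → ℝ) → ℂ, Continuous χ ∧ (∀ z, χ z ≠ 0) ∧
      ∀ F : (Fin k → ℝ) → ℂ, Continuous F → IsTwoPiPeriodic F →
        ∃ b : ℂ, ∀ z, Tendsto (fun T => lineAvg ν lam z T F) atTop (𝓝 (χ z * b)) := by
  by_cases h : ∃ m : Fin k → ℤ, ∑ i, (m i : ℝ) * ν i = lam
  · obtain ⟨m, rfl⟩ := h
    refine ⟨fun z => mFourier m (torusMk z), (mFourier m).continuous.comp continuous_torusMk,
      fun z => ?_, fun F hc hF => ?_⟩
    · simp only [mFourier_torusMk]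
      exact Complex.exp_ne_zero _
    · obtain ⟨g, hg⟩ := hF.exists_lift hc
      obtain rfl : (fun z => g (torusMk z)) = F := funext hg
      exact ⟨_, fun z => hν.tendsto_lineAvg m z g⟩
  · refine ⟨fun _ => 1, continuous_const, fun _ => one_ne_zero, fun F hc hF => ⟨0, fun z => ?_⟩⟩
    obtain ⟨g, hg⟩ := hF.exists_lift hc
    obtain rfl : (fun z => g (torusMk z)) = F := funext hg
    rw [mul_zero]
    exact tendsto_lineAvg_of_mFourier ν lam z 0 (fun n => by
      rw [if_neg fun hn => h ⟨n, hn⟩]; rfl) g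

/-- Kronecker's theorem, as a uniqueness statement: a continuous periodic function is determined
by its values on the line `ℝν`. If `H` vanishes on the line, the average of `|H|²` along the line is
zero, and it equals the integral over the torus. -/
theorem IsNonresonant.eq_zero_of_line {ν : Fin k → ℝ} (hν : IsNonresonant ν)
    {H : (Fin k → ℝ) → ℝ} (hc : Continuous H) (hH : IsTwoPiPeriodic H)
    (h : ∀ s : ℝ, H (s • ν) = 0) (z : Fin k → ℝ) : H z = 0 := by
  obtain ⟨g, hg⟩ := IsTwoPiPeriodic.exists_lift (F := fun z => (H z : ℂ))
    (fun i z => by simp only [hH i z]) (by fun_prop)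
  let g2 : C(UnitAddTorus (Fin k), ℂ) := ⟨fun x => ((‖g x‖ ^ 2 : ℝ) : ℂ), by fun_prop⟩
  have hlim := hν.tendsto_lineAvg 0 0 g2
  have hzero : ∀ T, lineAvg ν (∑ i, (((0 : Fin k → ℤ) i : ℤ) : ℝ) * ν i) 0 T
      (fun w => g2 (torusMk w)) = 0 := fun T => by
    simp [lineAvg, g2, hg, h]
  simp only [hzero] at hlim
  have hI := tendsto_nhds_unique hlim tendsto_const_nhds
  simp only [neg_zero, mFourier_zero, ContinuousMap.one_apply, one_mul, g2,
    ContinuousMap.coe_mk, integral_complex_ofReal, Complex.ofReal_eq_zero] at hI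
  by_contra hne
  have hpos := Continuous.integral_pos_of_hasCompactSupport_nonneg_nonzero
    (μ := torusMeasure k) (f := fun x => ‖g x‖ ^ 2) (x := torusMk z) (by fun_prop)
    (HasCompactSupport.of_compactSpace _) (fun x => by positivity) (by simpa [hg] using hne)
  exact hpos.ne' hI

end LineAverages

/-! ### Linear systems with skew-symmetric generator -/

theorem hasDerivAt_transpose_mul {A X Y : ℝ → Matrix (Fin 3) (Fin 3) ℝ}
    (hA : ∀ t, (A t)ᵀ = -A t)
    (hX : ∀ t i j, HasDerivAt (fun t => X t i j) ((A t * X t) i j) t)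
    (hY : ∀ t i j, HasDerivAt (fun t => Y t i j) ((A t * Y t) i j) t) (t : ℝ) (i j : Fin 3) :
    HasDerivAt (fun t => ((X t)ᵀ * Y t) i j) 0 t := by
  have h0 : ((A t * X t)ᵀ * Y t + (X t)ᵀ * (A t * Y t)) i j = 0 := by
    rw [Matrix.transpose_mul, hA, Matrix.mul_neg, Matrix.neg_mul, Matrix.mul_assoc,
      neg_add_cancel, Matrix.zero_apply]
  rw [← h0]
  simp only [Matrix.add_apply, Matrix.mul_apply (M := (X _)ᵀ),
    Matrix.mul_apply (M := (A t * X t)ᵀ), Matrix.transpose_apply, ← Finset.sum_add_distrib]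
  exact HasDerivAt.fun_sum fun k _ => (hX t k i).mul (hY t k j)

/-- Uniqueness of the principal solution. For skew-symmetric `A` the product `Xᵀ Y` of two solutions is
constant, so no Gronwall estimate is needed. -/
theorem eq_of_skew_system {A X Y : ℝ → Matrix (Fin 3) (Fin 3) ℝ}
    (hA : ∀ t, (A t)ᵀ = -A t) (hX0 : X 0 = 1) (hY0 : Y 0 = 1)
    (hX : ∀ t i j, HasDerivAt (fun t => X t i j) ((A t * X t) i j) t)
    (hY : ∀ t i j, HasDerivAt (fun t => Y t i j) ((A t * Y t) i j) t) : X = Y := by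
  have key : ∀ {Z : ℝ → Matrix (Fin 3) (Fin 3) ℝ}, Z 0 = 1 →
      (∀ t i j, HasDerivAt (fun t => Z t i j) ((A t * Z t) i j) t) →
      ∀ t, (X t)ᵀ * Z t = 1 := by
    intro Z hZ0 hZ t
    ext i j
    have hd := hasDerivAt_transpose_mul hA hX hZ
    rw [is_const_of_deriv_eq_zero (fun t => (hd t i j).differentiableAt)
      (fun t => (hd t i j).deriv) t 0, hX0, hZ0, Matrix.transpose_one, Matrix.one_mul]
  funext t
  have hXX : X t * (X t)ᵀ = 1 := mul_eq_one_comm.1 (key hX0 hX t)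
  calc X t = X t * ((X t)ᵀ * Y t) := by rw [key hY0 hY t, Matrix.mul_one]
    _ = Y t := by rw [← Matrix.mul_assoc, hXX, Matrix.one_mul]

/-- The rotation by the angle `t` about the third axis. -/
def rotZ (t : ℝ) : Matrix (Fin 3) (Fin 3) ℝ :=
  !![Real.cos t, -Real.sin t, 0; Real.sin t, Real.cos t, 0; 0, 0, 1]

theorem rotZ_zero : rotZ 0 = 1 := by
  ext i j
  fin_cases i <;> fin_cases j <;> simp [rotZ]

theorem rotZ_add (s t : ℝ) : rotZ (s + t) = rotZ s * rotZ t := by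
  ext i j
  fin_cases i <;> fin_cases j <;>
    simp [rotZ, Matrix.mul_apply, Fin.sum_univ_three, Real.cos_add, Real.sin_add] <;> ring

theorem continuous_rotZ : Continuous rotZ := by
  refine continuous_matrix fun i j => ?_
  fin_cases i <;> fin_cases j <;> simp [rotZ] <;> fun_prop

theorem hasDerivAt_rotZ (t : ℝ) (i j : Fin 3) :
    HasDerivAt (fun t => rotZ t i j) ((genJ * rotZ t) i j) t := by
  have hc := Real.hasDerivAt_cos t
  have hs := Real.hasDerivAt_sin t
  have hn := hs.neg
  fin_cases i <;> fin_cases j <;>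
    simp [rotZ, genJ, Matrix.mul_apply, Fin.sum_univ_three] <;>
    first
      | exact hc
      | exact hs
      | exact hn
      | exact hasDerivAt_const t _

theorem hasDerivAt_exp_smul_genJ (t : ℝ) (i j : Fin 3) :
    HasDerivAt (fun t : ℝ => NormedSpace.exp (t • genJ) i j)
      ((genJ * NormedSpace.exp (t • genJ)) i j) t := by
  let _ : NormedRing (Matrix (Fin 3) (Fin 3) ℝ) := Matrix.linftyOpNormedRing
  let _ : NormedAlgebra ℝ (Matrix (Fin 3) (Fin 3) ℝ) := Matrix.linftyOpNormedAlgebra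
  have : CompleteSpace (Matrix (Fin 3) (Fin 3) ℝ) := FiniteDimensional.complete ℝ _
  let L : Matrix (Fin 3) (Fin 3) ℝ →L[ℝ] ℝ :=
    LinearMap.toContinuousLinearMap (Matrix.entryLinearMap ℝ ℝ i j)
  exact L.hasFDerivAt.comp_hasDerivAt t (hasDerivAt_exp_smul_const' (𝕂 := ℝ) genJ t)

theorem exp_smul_genJ (t : ℝ) : NormedSpace.exp (t • genJ) = rotZ t := by
  refine congrFun (eq_of_skew_system (A := fun _ => genJ) (fun _ => ?_) ?_ rotZ_zero
    (fun t i j => hasDerivAt_exp_smul_genJ t i j) hasDerivAt_rotZ) t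
  · ext i j
    fin_cases i <;> fin_cases j <;> simp [genJ]
  · simp only [zero_smul, NormedSpace.exp_zero]

/-! ### Transport of a uniform precession frame to all orbital phases -/

namespace Torus

variable {d : ℕ} (𝒯 : Torus d)

/-- The generator as a function on the torus `(ℝ/2πℤ)ᵈ⁺¹`, with the origin of the orbital angles
placed at `φ₀`. -/
def gen (φ₀ : Fin d → ℝ) (z : Fin (d + 1) → ℝ) : Matrix (Fin 3) (Fin 3) ℝ :=
  𝒯.mat (z 0) (Fin.tail z + φ₀)

theorem continuous_gen (φ₀ : Fin d → ℝ) : Continuous (𝒯.gen φ₀) := by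
  refine continuous_matrix fun i j => ?_
  have h : Continuous fun z : Fin (d + 1) → ℝ => (z 0, Fin.tail z + φ₀) :=
    (continuous_apply 0).prodMk
      ((continuous_pi fun i : Fin d => continuous_apply i.succ).add continuous_const)
  exact (𝒯.mat_contDiff i j).continuous.comp h

theorem isTwoPiPeriodic_gen (φ₀ : Fin d → ℝ) : IsTwoPiPeriodic (𝒯.gen φ₀) := by
  intro i z
  refine Fin.cases ?_ (fun i => ?_) i
  · have h : Fin.tail (z + Pi.single 0 (2 * Real.pi)) = Fin.tail z := by
      funext j
      simp [Fin.tail]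
    simp only [gen, h, Pi.add_apply, Pi.single_eq_same, 𝒯.mat_periodic_theta]
  · have h : Fin.tail (z + Pi.single i.succ (2 * Real.pi)) + φ₀ =
        Fin.tail z + φ₀ + Pi.single i (2 * Real.pi) := by
      funext j
      by_cases hj : j = i
      · subst hj; simp [Fin.tail]; ring
      · simp [Fin.tail, hj]
    rw [gen, h, 𝒯.mat_periodic_phi, gen]
    congr 1
    simp

/-- The phase `φ` is reached from the origin `φ₀` by the point `(0, φ - φ₀)` of the torus. -/
theorem gen_orbit (φ₀ φ : Fin d → ℝ) (θ : ℝ) :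
    𝒯.gen φ₀ (Fin.cons 0 (φ - φ₀) + θ • 𝒯.tune) = 𝒯.orbitMat φ θ := by
  have h : Fin.tail ((Fin.cons 0 (φ - φ₀) : Fin (d + 1) → ℝ) + θ • 𝒯.tune) + φ₀ =
      θ • 𝒯.omega + φ := by
    funext j
    simp [Fin.tail, tune]
    ring
  rw [gen, h, orbitMat]
  simp [tune]

variable {𝒯}

/-- The frame is `Φ` times a smooth matrix function; in particular it is differentiable, although it
is only assumed quasiperiodic. -/
theorem IsProperUPF.frame_eq {φ₀ : Fin d → ℝ} {U : ℝ → Matrix (Fin 3) (Fin 3) ℝ} {ν : ℝ}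
    (h : 𝒯.IsProperUPF φ₀ U ν) (θ : ℝ) : U θ = 𝒯.Phi φ₀ θ * U 0 * rotZ (-(ν * θ)) := by
  have h0 : (U 0)ᵀ * U 0 = 1 :=
    (Matrix.mem_orthogonalGroup_iff' (Fin 3) ℝ).1
      (Matrix.mem_specialOrthogonalGroup_iff.1 (h.mem_SO3 0)).1
  rw [h.standard_form, exp_smul_genJ, Matrix.mul_assoc _ _ (U 0), h0, Matrix.mul_one,
    Matrix.mul_assoc, ← rotZ_add, add_neg_cancel, rotZ_zero, Matrix.mul_one]

/-- A proper uniform precession frame at `φ₀` extends to a continuous frame field on the torus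
that brings the principal solution matrix to standard form at every orbital phase. On the dense
line the standard form is inherited from `φ₀` by the flow; as an integral equation it extends to the
whole torus by continuity. -/
theorem IsProperUPF.exists_frameField (hres : 𝒯.OffOrbitalResonance) {φ₀ : Fin d → ℝ}
    {U : ℝ → Matrix (Fin 3) (Fin 3) ℝ} {ν : ℝ} (h : 𝒯.IsProperUPF φ₀ U ν) :
    ∃ V : (Fin (d + 1) → ℝ) → Matrix (Fin 3) (Fin 3) ℝ, Continuous V ∧ IsTwoPiPeriodic V ∧
      (∀ z, V z * (V z)ᵀ = 1) ∧
      ∀ φ θ, 𝒯.Phi φ θ = V (Fin.cons 0 (φ - φ₀) + θ • 𝒯.tune) * rotZ (ν * θ) *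
        (V (Fin.cons 0 (φ - φ₀)))ᵀ := by
  choose F hFc hFp hFU using h.quasiperiodic
  let V : (Fin (d + 1) → ℝ) → Matrix (Fin 3) (Fin 3) ℝ := fun z i j => F i j z
  have hVc : Continuous V := continuous_matrix fun i j => hFc i j
  have hVp : IsTwoPiPeriodic V := fun i z => by
    ext a b
    exact hFp a b i z
  have hVU : ∀ s : ℝ, V (s • 𝒯.tune) = U s := fun s => by
    ext a b
    exact (hFU a b s).symm
  have hVorth : ∀ z, V z * (V z)ᵀ = 1 := by
    intro z
    ext i j
    refine sub_eq_zero.1 (IsNonresonant.eq_zero_of_line hres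
      (H := fun z => (V z * (V z)ᵀ) i j - (1 : Matrix (Fin 3) (Fin 3) ℝ) i j) ?_ ?_ ?_ z)
    · exact ((hVc.matrix_mul hVc.matrix_transpose).matrix_elem i j).sub continuous_const
    · intro a z
      simp only [hVp a z]
    · intro s
      have := (Matrix.mem_orthogonalGroup_iff (Fin 3) ℝ).1
        (Matrix.mem_specialOrthogonalGroup_iff.1 (h.mem_SO3 s)).1
      rw [hVU, show U s * (U s)ᵀ = 1 from this, sub_self]
  -- the candidate for the principal solution along the orbit that starts at `z`
  let W : (Fin (d + 1) → ℝ) → ℝ → Matrix (Fin 3) (Fin 3) ℝ := fun z θ =>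
    V (z + θ • 𝒯.tune) * rotZ (ν * θ) * (V z)ᵀ
  have hW0 : ∀ z, W z 0 = 1 := fun z => by
    simp only [W, zero_smul, add_zero, mul_zero, rotZ_zero, Matrix.mul_one, hVorth]
  have hWc : Continuous fun p : (Fin (d + 1) → ℝ) × ℝ => W p.1 p.2 := by
    refine ((hVc.comp ?_).matrix_mul (continuous_rotZ.comp ?_)).matrix_mul
      (hVc.comp continuous_fst).matrix_transpose <;> fun_prop
  have hGc : Continuous fun p : (Fin (d + 1) → ℝ) × ℝ =>
      𝒯.gen φ₀ (p.1 + p.2 • 𝒯.tune) * W p.1 p.2 := by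
    refine ((𝒯.continuous_gen φ₀).comp ?_).matrix_mul hWc
    fun_prop
  have hshift : ∀ (a : Fin (d + 1)) (z w : Fin (d + 1) → ℝ),
      z + Pi.single a (2 * Real.pi) + w = z + w + Pi.single a (2 * Real.pi) := fun a z w =>
    add_right_comm _ _ _
  have hWp : ∀ θ, IsTwoPiPeriodic fun z => W z θ := fun θ a z => by
    simp only [W, hshift, hVp a _]
  have hline : ∀ (s t : ℝ) (i j : Fin 3), HasDerivAt (fun t => W (s • 𝒯.tune) t i j)
      ((𝒯.gen φ₀ (s • 𝒯.tune + t • 𝒯.tune) * W (s • 𝒯.tune) t) i j) t := by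
    intro s t i j
    have hWs : ∀ t, W (s • 𝒯.tune) t =
        𝒯.Phi φ₀ (s + t) * (U 0 * rotZ (-(ν * s)) * (U s)ᵀ) := by
      intro t
      have hrot : rotZ (-(ν * (s + t))) * rotZ (ν * t) = rotZ (-(ν * s)) := by
        rw [← rotZ_add]
        congr 1
        ring
      simp only [W, ← add_smul, hVU]
      rw [h.frame_eq (s + t), Matrix.mul_assoc _ _ (rotZ (ν * t)), hrot]
      simp only [Matrix.mul_assoc]
    have hgen : 𝒯.gen φ₀ (s • 𝒯.tune + t • 𝒯.tune) = 𝒯.orbitMat φ₀ (s + t) := by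
      rw [← 𝒯.gen_orbit φ₀ φ₀, ← add_smul]
      congr 1
      rw [sub_self, show (Fin.cons 0 0 : Fin (d + 1) → ℝ) = 0 from Fin.cons_self_tail 0,
        zero_add]
    simp only [hgen, hWs, ← Matrix.mul_assoc (𝒯.orbitMat φ₀ (s + t)), Matrix.mul_apply
      (N := U 0 * rotZ (-(ν * s)) * (U s)ᵀ)]
    refine HasDerivAt.fun_sum fun l _ => HasDerivAt.mul_const ?_ _
    exact HasDerivAt.comp_const_add s t (𝒯.hasDerivAt_Phi φ₀ (s + t) i l)
  -- both sides are continuous and periodic in `z`, whereas the derivative of `W z` in `θ` is not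
  -- known to exist off the line
  have hint : ∀ z θ i j, W z θ i j = (1 : Matrix (Fin 3) (Fin 3) ℝ) i j +
      ∫ t in (0 : ℝ)..θ, (𝒯.gen φ₀ (z + t • 𝒯.tune) * W z t) i j := by
    intro z θ i j
    refine sub_eq_zero.1 (IsNonresonant.eq_zero_of_line hres
      (H := fun z => W z θ i j - ((1 : Matrix (Fin 3) (Fin 3) ℝ) i j +
        ∫ t in (0 : ℝ)..θ, (𝒯.gen φ₀ (z + t • 𝒯.tune) * W z t) i j)) ?_ ?_ ?_ z)
    · refine ((hWc.comp (continuous_id.prodMk continuous_const)).matrix_elem i j).sub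
        (continuous_const.add ?_)
      exact intervalIntegral.continuous_parametric_intervalIntegral_of_continuous'
        (hGc.matrix_elem i j) 0 θ
    · intro a z
      simp only [(hWp _ a z), hshift, 𝒯.isTwoPiPeriodic_gen φ₀ a _]
    · intro s
      rw [intervalIntegral.integral_eq_sub_of_hasDerivAt (fun t _ => hline s t i j), hW0]
      · ring
      · refine Continuous.intervalIntegrable ?_ _ _
        exact (hGc.comp (continuous_const.prodMk continuous_id)).matrix_elem i j
  have hder : ∀ z t i j, HasDerivAt (fun t => W z t i j)
      ((𝒯.gen φ₀ (z + t • 𝒯.tune) * W z t) i j) t := by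
    intro z t i j
    have hc : Continuous fun t => (𝒯.gen φ₀ (z + t • 𝒯.tune) * W z t) i j :=
      (hGc.comp (continuous_const.prodMk continuous_id)).matrix_elem i j
    have := (hc.integral_hasStrictDerivAt 0 t).hasDerivAt.const_add
      ((1 : Matrix (Fin 3) (Fin 3) ℝ) i j)
    exact this.congr_of_eventuallyEq (Eventually.of_forall fun t => hint z t i j)
  refine ⟨V, hVc, hVp, hVorth, fun φ θ => ?_⟩
  refine congrFun (eq_of_skew_system (A := 𝒯.orbitMat φ) (Y := W (Fin.cons 0 (φ - φ₀)))
    (fun t => 𝒯.mat_skew _ _) (𝒯.Phi_zero φ) (hW0 _) (𝒯.hasDerivAt_Phi φ)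
    fun t i j => ?_) θ
  rw [← 𝒯.gen_orbit φ₀ φ]
  exact hder _ t i j

end Torus

/-! ### Coefficients of the principal solution matrix -/

/-- The eigenprojections of the generator of the rotations about the third axis, for the eigenvalues
`i`, `-i` and `0`. -/
def rotProj : Fin 3 → Matrix (Fin 3) (Fin 3) ℂ :=
  ![!![1 / 2, Complex.I / 2, 0; -Complex.I / 2, 1 / 2, 0; 0, 0, 0],
    !![1 / 2, -Complex.I / 2, 0; Complex.I / 2, 1 / 2, 0; 0, 0, 0],
    !![0, 0, 0; 0, 0, 0; 0, 0, 1]]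

/-- The frequencies `1`, `-1`, `0` belonging to the projections `rotProj`. -/
def rotFreq : Fin 3 → ℝ := ![1, -1, 0]

theorem rotZ_map_eq_sum (t : ℝ) (p q : Fin 3) :
    ((rotZ t p q : ℝ) : ℂ) =
      ∑ n, rotProj n p q * Complex.exp (Complex.I * ((rotFreq n * t : ℝ) : ℂ)) := by
  have h1 : Complex.exp (Complex.I * t) = Complex.cos t + Complex.sin t * Complex.I := by
    rw [mul_comm, Complex.exp_mul_I]
  have h2 : Complex.exp (-(Complex.I * t)) = Complex.cos t - Complex.sin t * Complex.I := by
    rw [← mul_neg, mul_comm, Complex.exp_mul_I, Complex.cos_neg, Complex.sin_neg]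
    ring
  have hI := Complex.I_sq
  fin_cases p <;> fin_cases q <;>
    simp [rotZ, rotProj, rotFreq, Fin.sum_univ_three, h1, h2] <;> grind

theorem rotProj_mul_rotProj (m n : Fin 3) :
    rotProj m * rotProj n = if m = n then rotProj n else 0 := by
  have hI := Complex.I_sq
  ext p q
  fin_cases m <;> fin_cases n <;> fin_cases p <;> fin_cases q <;>
    simp [rotProj, Matrix.mul_apply, Fin.sum_univ_three] <;> grind

theorem sum_smul_mul_rotProj_eq_zero_iff {c : Fin 3 → ℂ} (hc : ∀ n, c n ≠ 0)
    (B : Fin 3 → Matrix (Fin 3) (Fin 3) ℂ) {O : Matrix (Fin 3) (Fin 3) ℂ} (hO : O * Oᵀ = 1) :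
    (∑ n, c n • (B n * rotProj n)) * Oᵀ = 0 ↔ ∀ n, B n * rotProj n = 0 := by
  constructor
  · intro h n
    have h1 : ∑ n, c n • (B n * rotProj n) = 0 := by
      rw [← Matrix.mul_one (∑ n, c n • (B n * rotProj n)), ← mul_eq_one_comm.1 hO,
        ← Matrix.mul_assoc, h, Matrix.zero_mul]
    have h2 := congrArg (· * rotProj n) h1
    simp only [Matrix.sum_mul, Matrix.smul_mul, Matrix.mul_assoc, rotProj_mul_rotProj,
      Matrix.zero_mul, mul_ite, Matrix.mul_zero, smul_ite, smul_zero, Finset.sum_ite_eq',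
      Finset.mem_univ, if_true] at h2
    exact (smul_eq_zero.1 h2).resolve_left (hc n)
  · intro h
    simp [h]

/-- The coefficient of a triple product whose last factor is constant and whose middle factor is a
rotation. -/
theorem hasCoeff_of_tendsto_lineAvg {k : ℕ} {τ z : Fin k → ℝ} {ν lam : ℝ}
    {V : (Fin k → ℝ) → Matrix (Fin 3) (Fin 3) ℝ} (hV : Continuous V)
    {f : ℝ → Matrix (Fin 3) (Fin 3) ℂ}
    (hf : ∀ θ, f θ = (V (z + θ • τ) * rotZ (ν * θ) * (V z)ᵀ).map fun x : ℝ => (x : ℂ))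
    (M : Fin 3 → Matrix (Fin 3) (Fin 3) ℂ)
    (hM : ∀ n i p, Tendsto
      (fun T => lineAvg τ (lam - rotFreq n * ν) z T fun w => ((V w i p : ℝ) : ℂ)) atTop
      (𝓝 (M n i p))) :
    HasCoeff f lam
      ((∑ n, M n * rotProj n) * ((V z).map fun x : ℝ => (x : ℂ))ᵀ) := by
  intro i j
  have hc : ∀ i p, Continuous fun w => ((V w i p : ℝ) : ℂ) := fun i p =>
    Complex.continuous_ofReal.comp (hV.matrix_elem i p)
  have hprod : ∀ θ : ℝ, f θ i j * Complex.exp (-Complex.I * (lam : ℂ) * (θ : ℂ)) =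
      ∑ x : Fin 3 × Fin 3 × Fin 3, rotProj x.2.2 x.2.1 x.1 * ((V z j x.1 : ℝ) : ℂ) *
        (((V (z + θ • τ) i x.2.1 : ℝ) : ℂ) *
          Complex.exp (-Complex.I * ((lam - rotFreq x.2.2 * ν : ℝ) : ℂ) * (θ : ℂ))) := by
    intro θ
    rw [hf]
    simp only [Matrix.map_apply, Matrix.mul_apply, Matrix.transpose_apply, Complex.ofReal_sum,
      Complex.ofReal_mul, rotZ_map_eq_sum, Fintype.sum_prod_type, Finset.sum_mul, Finset.mul_sum]
    refine Finset.sum_congr rfl fun q _ => Finset.sum_congr rfl fun p _ =>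
      Finset.sum_congr rfl fun n _ => ?_
    have hexp : Complex.exp (-Complex.I * ((lam : ℂ) - (rotFreq n : ℂ) * (ν : ℂ)) * (θ : ℂ)) =
        Complex.exp (Complex.I * ((rotFreq n : ℂ) * ((ν : ℂ) * (θ : ℂ)))) *
          Complex.exp (-Complex.I * (lam : ℂ) * (θ : ℂ)) := by
      rw [← Complex.exp_add]
      congr 1
      ring
    push_cast
    rw [hexp]
    ring
  have hlim : Tendsto (fun T => ∑ x : Fin 3 × Fin 3 × Fin 3,
      rotProj x.2.2 x.2.1 x.1 * ((V z j x.1 : ℝ) : ℂ) *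
        lineAvg τ (lam - rotFreq x.2.2 * ν) z T fun w => ((V w i x.2.1 : ℝ) : ℂ)) atTop
      (𝓝 (∑ x : Fin 3 × Fin 3 × Fin 3,
        rotProj x.2.2 x.2.1 x.1 * ((V z j x.1 : ℝ) : ℂ) * M x.2.2 i x.2.1)) :=
    tendsto_finsetSum _ fun x _ => (hM x.2.2 i x.2.1).const_mul _
  have hval : (∑ x : Fin 3 × Fin 3 × Fin 3,
        rotProj x.2.2 x.2.1 x.1 * ((V z j x.1 : ℝ) : ℂ) * M x.2.2 i x.2.1) =
      ((∑ n, M n * rotProj n) * ((V z).map fun x : ℝ => (x : ℂ))ᵀ) i j := by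
    simp only [Matrix.mul_apply, Matrix.transpose_apply, Matrix.map_apply, Matrix.sum_apply,
      Fintype.sum_prod_type, Finset.sum_mul]
    refine Finset.sum_congr rfl fun q _ => ?_
    rw [Finset.sum_comm]
    refine Finset.sum_congr rfl fun n _ => Finset.sum_congr rfl fun p _ => ?_
    ring
  rw [← hval]
  refine hlim.congr fun T => ?_
  simp only [hprod]
  rw [intervalIntegral.integral_finsetSum, Finset.mul_sum]
  · refine Finset.sum_congr rfl fun x _ => ?_
    rw [intervalIntegral.integral_const_mul, lineAvg]
    ring
  · intro x _
    exact ((continuous_line_integrand τ _ z (hc i x.2.1)).const_mul _).intervalIntegrable _ _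

theorem HasCoeff.unique {f : ℝ → Matrix (Fin 3) (Fin 3) ℂ} {lam : ℝ}
    {a b : Matrix (Fin 3) (Fin 3) ℂ} (ha : HasCoeff f lam a) (hb : HasCoeff f lam b) : a = b := by
  ext i j
  exact tendsto_nhds_unique (ha i j) (hb i j)

theorem HasCoeff.mem_specSet_iff {f : ℝ → Matrix (Fin 3) (Fin 3) ℂ} {lam : ℝ}
    {a : Matrix (Fin 3) (Fin 3) ℂ} (ha : HasCoeff f lam a) : lam ∈ specSet f ↔ a ≠ 0 :=
  ⟨fun ⟨_, hb, hb0⟩ => hb.unique ha ▸ hb0, fun h => ⟨a, ha, h⟩⟩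

/-- At each frequency the coefficients exist, are continuous in the orbital phase, and vanish
either at every phase or at none. -/
theorem Torus.exists_coeff {d : ℕ} (𝒯 : Torus d) (hres : 𝒯.OffOrbitalResonance)
    (φ₀ : Fin d → ℝ) (hΞ : (𝒯.Xi φ₀).Nonempty) (lam : ℝ) :
    ∃ a : (Fin d → ℝ) → Matrix (Fin 3) (Fin 3) ℂ,
      (∀ φ, HasCoeff (𝒯.PhiC φ) lam (a φ)) ∧ Continuous a ∧ ∀ φ φ', a φ = 0 ↔ a φ' = 0 := by
  obtain ⟨ν, U, hU⟩ := hΞ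
  obtain ⟨V, hVc, hVp, hVorth, hPhi⟩ := hU.exists_frameField hres
  choose χ hχc hχ0 hχ using fun n : Fin 3 =>
    IsNonresonant.exists_tendsto_lineAvg hres (lam - rotFreq n * ν)
  have hVC : ∀ i p, Continuous fun w => ((V w i p : ℝ) : ℂ) := fun i p =>
    Complex.continuous_ofReal.comp (hVc.matrix_elem i p)
  choose B hB using fun n i p => hχ n (fun w => ((V w i p : ℝ) : ℂ)) (hVC i p)
    fun a z => by simp only [hVp a z]
  let z : (Fin d → ℝ) → Fin (d + 1) → ℝ := fun φ => Fin.cons 0 (φ - φ₀)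
  have hz : Continuous z :=
    (continuous_const (y := (0 : ℝ))).finCons (continuous_id.sub continuous_const)
  let O : (Fin d → ℝ) → Matrix (Fin 3) (Fin 3) ℂ := fun φ =>
    (V (z φ)).map fun x : ℝ => (x : ℂ)
  have hO : ∀ φ, O φ * (O φ)ᵀ = 1 := by
    intro φ
    have := congrArg (fun M : Matrix (Fin 3) (Fin 3) ℝ => M.map Complex.ofRealHom)
      (hVorth (z φ))
    simp only [Matrix.map_mul, Matrix.transpose_map,
      Matrix.map_one _ (map_zero _) (map_one _)] at this
    exact this
  refine ⟨fun φ => (∑ n, χ n (z φ) • (Matrix.of (B n) * rotProj n)) * (O φ)ᵀ,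
    fun φ => ?_, ?_, fun φ φ' => ?_⟩
  · have := hasCoeff_of_tendsto_lineAvg (τ := 𝒯.tune) (z := z φ) (ν := ν) (lam := lam) hVc
      (f := 𝒯.PhiC φ) (fun θ => by rw [PhiC, hPhi φ θ])
      (fun n => χ n (z φ) • Matrix.of (B n)) (fun n i p => hB n i p (z φ))
    simpa only [Matrix.smul_mul] using this
  · refine Continuous.matrix_mul (continuous_finsetSum _ fun n _ => ?_) ?_
    · exact ((hχc n).comp hz).smul continuous_const
    · exact (continuous_matrix fun i p => (hVC i p).comp hz).matrix_transpose
  · rw [sum_smul_mul_rotProj_eq_zero_iff (fun n => hχ0 n _) _ (hO φ),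
      sum_smul_mul_rotProj_eq_zero_iff (fun n => hχ0 n _) _ (hO φ')]

end SpinOrbit

end

theorem theorem9p2 {d : ℕ} (𝒯 : SpinOrbit.Torus d) (hres : 𝒯.OffOrbitalResonance)
    (φ₀ : Fin d → ℝ) (hΞ : (𝒯.Xi φ₀).Nonempty) :
    (∀ lam : ℝ, ∃ a : (Fin d → ℝ) → Matrix (Fin 3) (Fin 3) ℂ,
        (∀ φ : Fin d → ℝ, SpinOrbit.HasCoeff (𝒯.PhiC φ) lam (a φ)) ∧ Continuous a) ∧
      ∀ φ : Fin d → ℝ,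
        SpinOrbit.specSet (𝒯.PhiC φ) = SpinOrbit.specSet (𝒯.PhiC φ₀) := by
  refine ⟨fun lam => ?_, fun φ => ?_⟩
  · obtain ⟨a, ha, hc, -⟩ := 𝒯.exists_coeff hres φ₀ hΞ lam
    exact ⟨a, ha, hc⟩
  · ext lam
    obtain ⟨a, ha, -, h0⟩ := 𝒯.exists_coeff hres φ₀ hΞ lam
    rw [(ha φ).mem_specSet_iff, (ha φ₀).mem_specSet_iff]
    exact not_congr (h0 φ φ₀)
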